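/- Write $M_n$ for the algebra of $n\times n$ complex matrices. Let $\Phi: M_n\to M_m$ be a quantum channel, i.e. a completely positive trace-preserving linear map, and for a linear map $\Psi$ between matrix algebras let $\Psi^\dagger$ denote its dual with respect to the trace pairing, $\mathrm{tr}(\Psi(Y)X)=\mathrm{tr}(Y\,\Psi^\dagger(X))$. Let $\mathcal A,\mathcal B\subseteq M_n$ be unital $*$-subalgebras (containing $I_n$) such that (i) $\mathcal A$ is correctable for $\Phi$: there is a channel $\mathcal R: M_m\to \mathcal A$ (that is, a completely positive trace-preserving map $M_m\to M_n$ with range in $\mathcal A$) with $\Phi^\dagger(\mathcal R^\dagger(X))=X$ for all $X\in\mathcal A$; (ii) $\mathcal B$ is privatized to a state by $\Phi$: there is a density matrix $\rho\in M_m$ (positive semidefinite with trace $1$) with $\Phi(X)=\mathrm{tr}(X)\,\rho$ for all $X\in\mathcal B$. Then $$\dim(\mathcal B)\le\dim(\mathcal A')\quad\text{and}\quad \dim(\mathcal A)\le\dim(\mathcal B'),$$ where $\dim$ is the complex dimension and $\mathcal S'=\{X\in M_n : XS=SX \text{ for all } S\in\mathcal S\}$ is the commutant in $M_n$. -/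

import Mathlib

section ChannelDefs

open scoped ComplexOrder MatrixOrder Matrix.Norms.L2Operator CStarAlgebra

/-- `Φ : M_n → M_m` is a quantum channel: it is completely positive (it is the underlying map of
a completely positive map between the C⋆-algebras `M_n` and `M_m`, with the operator norm and
the positive semidefinite order) and trace preserving. -/
def IsChannel {n m : ℕ}
    (Φ : Matrix (Fin n) (Fin n) ℂ →ₗ[ℂ] Matrix (Fin m) (Fin m) ℂ) : Prop :=
  (∃ Ψ : Matrix (Fin n) (Fin n) ℂ →CP Matrix (Fin m) (Fin m) ℂ, ∀ X, Ψ X = Φ X) ∧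
    ∀ X, (Φ X).trace = X.trace

/-- The dual map `Φ†` of `Φ` for the trace pairing: `tr (Φ(Y) X) = tr (Y Φ†(X))`, see
`trace_mul_dualMap`. It is determined by its entries
`Φ†(X) i j = tr (E_{ji} Φ†(X)) = tr (Φ(E_{ji}) X)`. -/
def dualMap {n m : ℕ}
    (Φ : Matrix (Fin n) (Fin n) ℂ →ₗ[ℂ] Matrix (Fin m) (Fin m) ℂ) :
    Matrix (Fin m) (Fin m) ℂ →ₗ[ℂ] Matrix (Fin n) (Fin n) ℂ where
  toFun X := Matrix.of fun i j => (Φ (Matrix.single j i 1) * X).trace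
  map_add' X Y := by
    ext i j
    simp [Matrix.mul_add]
  map_smul' c X := by
    ext i j
    simp

/-- The defining property of the dual map. -/
theorem trace_mul_dualMap {n m : ℕ}
    (Φ : Matrix (Fin n) (Fin n) ℂ →ₗ[ℂ] Matrix (Fin m) (Fin m) ℂ)
    (Y : Matrix (Fin n) (Fin n) ℂ) (X : Matrix (Fin m) (Fin m) ℂ) :
    (Y * dualMap Φ X).trace = (Φ Y * X).trace := by
  conv_rhs => rw [Matrix.matrix_eq_sum_single Y]
  have h : ∀ i j, Matrix.single i j (Y i j) = Y i j • Matrix.single i j (1 : ℂ) := by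
    intro i j
    simp [Matrix.smul_single]
  simp only [h, map_sum, map_smul, Finset.sum_mul, Matrix.trace_sum, Matrix.smul_mul,
    Matrix.trace_smul, smul_eq_mul]
  simp [Matrix.trace, Matrix.mul_apply, dualMap]

/-- A unital ⋆-subalgebra `A ⊆ M_n` is correctable for `Φ : M_n → M_m` if there is a channel
`R : M_m → A` (a channel into `M_n` with range in `A`) such that `Φ† ∘ R†` is the identity
on `A`. -/
def IsCorrectable {n m : ℕ} (A : StarSubalgebra ℂ (Matrix (Fin n) (Fin n) ℂ))
    (Φ : Matrix (Fin n) (Fin n) ℂ →ₗ[ℂ] Matrix (Fin m) (Fin m) ℂ) : Prop :=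
  ∃ R : Matrix (Fin m) (Fin m) ℂ →ₗ[ℂ] Matrix (Fin n) (Fin n) ℂ,
    IsChannel R ∧ (∀ Y, R Y ∈ A) ∧ ∀ X ∈ A, dualMap Φ (dualMap R X) = X

/-- A unital ⋆-subalgebra `B ⊆ M_n` is privatized to a state by `Φ : M_n → M_m` if there is a
density matrix `ρ` with `Φ(X) = tr(X) ρ` for all `X ∈ B`. -/
def IsPrivatizedToState {n m : ℕ} (B : StarSubalgebra ℂ (Matrix (Fin n) (Fin n) ℂ))
    (Φ : Matrix (Fin n) (Fin n) ℂ →ₗ[ℂ] Matrix (Fin m) (Fin m) ℂ) : Prop :=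
  ∃ ρ : Matrix (Fin m) (Fin m) ℂ,
    ρ.PosSemidef ∧ ρ.trace = 1 ∧ ∀ X ∈ B, Φ X = X.trace • ρ

end ChannelDefs

namespace Matrix

variable {n : ℕ}

open _root_.Module

/-! Correctability and privacy make the algebras trace-independent: `n * tr (XY) = tr X * tr Y` for
`X ∈ A`, `Y ∈ B`. Products of Hilbert–Schmidt orthonormal bases of `A` and `B` are then orthogonal,
so `dim A * dim B ≤ n²`. Any unital ⋆-subalgebra satisfies `n² ≤ dim A * dim A'`, by Cauchy–Schwarz
applied to the traces of the averaging map `sandwich` and of its square. Cancelling `dim A` gives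
the first bound; the roles of `A` and `B` are symmetric. -/

open scoped ComplexOrder in
/-- Every subspace of `M_n` has an orthonormal basis for the Hilbert–Schmidt inner product. -/
theorem exists_trace_orthonormal_basis (W : Submodule ℂ (Matrix (Fin n) (Fin n) ℂ)) :
    ∃ w : Fin (finrank ℂ W) → Matrix (Fin n) (Fin n) ℂ, (∀ i, w i ∈ W) ∧
      (∀ i j, (w i * (w j)ᴴ).trace = if i = j then 1 else 0) ∧
      ∀ X ∈ W, X = ∑ i, (X * (w i)ᴴ).trace • w i := by
  let _ : NormedAddCommGroup (Matrix (Fin n) (Fin n) ℂ) :=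
    toMatrixNormedAddCommGroup 1 PosDef.one
  let _ : InnerProductSpace ℂ (Matrix (Fin n) (Fin n) ℂ) :=
    toMatrixInnerProductSpace 1 PosDef.one.posSemidef
  have hinner : ∀ X Y : Matrix (Fin n) (Fin n) ℂ, inner ℂ X Y = (Y * Xᴴ).trace := fun X Y => by
    change (Y * 1 * Xᴴ).trace = _
    rw [mul_one]
  let b := stdOrthonormalBasis ℂ W
  refine ⟨fun i => (b i : Matrix (Fin n) (Fin n) ℂ), fun i => (b i).2, fun i j => ?_,
    fun X hX => ?_⟩
  · rw [← hinner, ← Submodule.coe_inner, orthonormal_iff_ite.mp b.orthonormal]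
    simp [eq_comm]
  · have h := congrArg (fun x : W => (x : Matrix (Fin n) (Fin n) ℂ)) (b.sum_repr' ⟨X, hX⟩)
    simp only [AddSubmonoidClass.coe_finsetSum, Submodule.coe_smul, Submodule.coe_inner,
      hinner] at h
    exact h.symm

/-- The trace of `X ↦ a * X * b` on `M_n` is `tr a * tr b`. -/
theorem trace_mulLeft_comp_mulRight (a b : Matrix (Fin n) (Fin n) ℂ) :
    LinearMap.trace ℂ _ (LinearMap.mulLeft ℂ a ∘ₗ LinearMap.mulRight ℂ b) =
      a.trace * b.trace := by
  rw [LinearMap.trace_eq_matrix_trace ℂ (stdBasis ℂ (Fin n) (Fin n)), trace,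
    Fintype.sum_prod_type, trace, trace, Finset.sum_mul_sum]
  refine Finset.sum_congr rfl fun i _ => Finset.sum_congr rfl fun j _ => ?_
  rw [diag_apply, LinearMap.toMatrix_apply, stdBasis_eq_single]
  change (a * (single i j (1 : ℂ) * b) : Matrix (Fin n) (Fin n) ℂ) i j = _
  rw [← mul_assoc, mul_apply, Finset.sum_eq_single j]
  · simp
  · intro k _ hk
    simp [hk]
  · simp

/-- The trace of an endomorphism of `M_n` with range in a subspace `W` is computed on an
orthonormal basis of `W`. -/
theorem trace_eq_sum_trace_of_mem {ι : Type*} [Fintype ι]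
    {W : Submodule ℂ (Matrix (Fin n) (Fin n) ℂ)} {w : ι → Matrix (Fin n) (Fin n) ℂ}
    (hw : ∀ X ∈ W, X = ∑ i, (X * (w i)ᴴ).trace • w i)
    (T : Matrix (Fin n) (Fin n) ℂ →ₗ[ℂ] Matrix (Fin n) (Fin n) ℂ) (hT : ∀ X, T X ∈ W) :
    LinearMap.trace ℂ _ T = ∑ i, (T (w i) * (w i)ᴴ).trace := by
  -- `T` is a sum of rank-one maps, and the trace of each is its functional evaluated at its vector.
  have h : T = ∑ i, (traceLinearMap (Fin n) ℂ ℂ ∘ₗ LinearMap.mulRight ℂ (w i)ᴴ ∘ₗ T).smulRight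
      (w i) := by
    ext1 X
    conv_lhs => rw [hw _ (hT X)]
    simp
  conv_lhs => rw [h]
  simp [LinearMap.trace_smulRight]

/-- The averaging map `X ↦ ∑ i, a i * X * (a i)ᴴ`. -/
def sandwich {ι : Type*} [Fintype ι] (a : ι → Matrix (Fin n) (Fin n) ℂ) :
    Matrix (Fin n) (Fin n) ℂ →ₗ[ℂ] Matrix (Fin n) (Fin n) ℂ :=
  ∑ i, LinearMap.mulLeft ℂ (a i) ∘ₗ LinearMap.mulRight ℂ (a i)ᴴ

theorem sandwich_apply {ι : Type*} [Fintype ι] (a : ι → Matrix (Fin n) (Fin n) ℂ)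
    (X : Matrix (Fin n) (Fin n) ℂ) : sandwich a X = ∑ i, a i * X * (a i)ᴴ := by
  simp [sandwich, mul_assoc]

/-- For an orthonormal basis of a `⋆`-subalgebra `A`, `sandwich` maps into the commutant of `A`. -/
theorem sandwich_mem_centralizer {ι : Type*} [Fintype ι]
    (A : StarSubalgebra ℂ (Matrix (Fin n) (Fin n) ℂ)) {a : ι → Matrix (Fin n) (Fin n) ℂ}
    (ha : ∀ i, a i ∈ A) (hrep : ∀ X ∈ A, X = ∑ i, (X * (a i)ᴴ).trace • a i)
    (X : Matrix (Fin n) (Fin n) ℂ) :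
    sandwich a X ∈ Subalgebra.centralizer ℂ (A : Set (Matrix (Fin n) (Fin n) ℂ)) := by
  rw [Subalgebra.mem_centralizer_iff]
  intro c hc
  have hc' : cᴴ ∈ A := star_mem hc
  have h1 : ∀ i, c * a i = ∑ k, (c * a i * (a k)ᴴ).trace • a k :=
    fun i => hrep _ (mul_mem hc (ha i))
  -- The coefficients are those of `h1`, so `c` passes from the left factor to the right one when
  -- the sums are swapped.
  have h2 : ∀ k, (a k)ᴴ * c = ∑ i, (c * a i * (a k)ᴴ).trace • (a i)ᴴ := fun k => by
    have h := congrArg conjTranspose (hrep _ (mul_mem hc' (ha k)))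
    simp only [conjTranspose_mul, conjTranspose_conjTranspose, conjTranspose_sum,
      conjTranspose_smul, ← trace_conjTranspose] at h
    rw [h]
    refine Finset.sum_congr rfl fun i _ => ?_
    rw [← mul_assoc, trace_mul_comm, ← mul_assoc]
  rw [sandwich_apply, Finset.mul_sum, Finset.sum_mul]
  calc ∑ i, c * (a i * X * (a i)ᴴ) = ∑ i, (c * a i) * X * (a i)ᴴ := by simp only [mul_assoc]
    _ = ∑ i, ∑ k, (c * a i * (a k)ᴴ).trace • (a k * X * (a i)ᴴ) := by
        refine Finset.sum_congr rfl fun i _ => ?_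
        conv_lhs => rw [h1 i]
        simp only [Finset.sum_mul, smul_mul_assoc]
    _ = ∑ k, ∑ i, (c * a i * (a k)ᴴ).trace • (a k * X * (a i)ᴴ) := Finset.sum_comm
    _ = ∑ k, a k * X * ((a k)ᴴ * c) := by
        refine Finset.sum_congr rfl fun k _ => ?_
        rw [h2 k, Finset.mul_sum]
        simp only [mul_smul_comm]
    _ = _ := by simp only [mul_assoc]

/-- `n² ≤ dim A * dim A'` for a unital `⋆`-subalgebra `A` of `M_n`. -/
theorem sq_le_finrank_mul_finrank_centralizer
    (A : StarSubalgebra ℂ (Matrix (Fin n) (Fin n) ℂ)) :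
    n ^ 2 ≤ finrank ℂ A *
      finrank ℂ (Subalgebra.centralizer ℂ (A : Set (Matrix (Fin n) (Fin n) ℂ))) := by
  obtain ⟨a, ha, hao, harep⟩ := exists_trace_orthonormal_basis A.toSubalgebra.toSubmodule
  obtain ⟨w, hw, hwo, hwrep⟩ := exists_trace_orthonormal_basis
    (Subalgebra.centralizer ℂ (A : Set (Matrix (Fin n) (Fin n) ℂ))).toSubmodule
  change n ^ 2 ≤ finrank ℂ A.toSubalgebra.toSubmodule * finrank ℂ (Subalgebra.centralizer ℂ
    (A : Set (Matrix (Fin n) (Fin n) ℂ))).toSubmodule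
  have hmem := sandwich_mem_centralizer A ha harep
  set S := ∑ i, a i * (a i)ᴴ with hS
  have hSh : Sᴴ = S := by simp [hS, conjTranspose_sum]
  have hcomm : ∀ X ∈ Subalgebra.centralizer ℂ (A : Set (Matrix (Fin n) (Fin n) ℂ)),
      sandwich a X = X * S := fun X hX => by
    rw [sandwich_apply, hS, Finset.mul_sum]
    refine Finset.sum_congr rfl fun i _ => ?_
    rw [(Subalgebra.mem_centralizer_iff ℂ).mp hX _ (ha i), mul_assoc]
  -- Expanding `1 ∈ A` in the basis and taking traces gives `∑ |tr (a i)|² = n`.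
  have htr1 : LinearMap.trace ℂ _ (sandwich a) = n := by
    have h := congrArg trace (harep 1 (one_mem A))
    simp only [trace_one, Fintype.card_fin, one_mul, trace_sum, trace_smul, smul_eq_mul] at h
    rw [h, sandwich, map_sum]
    exact Finset.sum_congr rfl fun i _ => by rw [trace_mulLeft_comp_mulRight, mul_comm]
  have htr2 : LinearMap.trace ℂ _ (sandwich a ∘ₗ sandwich a) =
      finrank ℂ A.toSubalgebra.toSubmodule := by
    have h : sandwich a ∘ₗ sandwich a = ∑ i, ∑ k,
        LinearMap.mulLeft ℂ (a i * a k) ∘ₗ LinearMap.mulRight ℂ ((a k)ᴴ * (a i)ᴴ) := by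
      ext1 X
      simp only [LinearMap.comp_apply, sandwich_apply, Finset.mul_sum, Finset.sum_mul, mul_assoc,
        LinearMap.sum_apply, LinearMap.mulLeft_apply, LinearMap.mulRight_apply]
    -- Parseval for the unit vector `(a i)ᴴ`, which lies in `A`.
    have h' : ∀ i, ∑ k, (a i * a k).trace * ((a k)ᴴ * (a i)ᴴ).trace = 1 := fun i => by
      have h := congrArg (fun X => (a i * X).trace) (harep (a i)ᴴ
        (star_mem (s := A) (ha i)))
      simp only [hao, if_true, Finset.mul_sum, mul_smul_comm, trace_sum, trace_smul,
        smul_eq_mul] at h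
      rw [h]
      exact Finset.sum_congr rfl fun k _ => by rw [mul_comm, trace_mul_comm (a k)ᴴ]
    simp only [h, map_sum, trace_mulLeft_comp_mulRight, h']
    simp
  rw [trace_eq_sum_trace_of_mem hwrep _ hmem] at htr1
  rw [trace_eq_sum_trace_of_mem hwrep (sandwich a ∘ₗ sandwich a) fun X => hmem _] at htr2
  simp only [LinearMap.comp_apply, hcomm _ (hmem _)] at htr2
  simp only [hcomm _ (hw _)] at htr1 htr2
  -- The quadratic is `∑ j, ‖w j * (S - t)‖²` in the Hilbert–Schmidt norm; its discriminant being
  -- nonpositive is Cauchy–Schwarz.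
  have key : ∀ t : ℝ, 0 ≤ (finrank ℂ (Subalgebra.centralizer ℂ
      (A : Set (Matrix (Fin n) (Fin n) ℂ))).toSubmodule : ℝ) * (t * t) + (-2 * n) * t +
        finrank ℂ A.toSubalgebra.toSubmodule := fun t => by
    have h : ∀ j, 0 ≤ ((w j * (S - (t : ℂ) • 1)) * (w j * (S - (t : ℂ) • 1))ᴴ).trace.re :=
      fun j => by
        open scoped ComplexOrder in
        exact (Complex.nonneg_iff.mp (posSemidef_self_mul_conjTranspose _).trace_nonneg).1
    have h2 : ∀ j, ((w j * (S - (t : ℂ) • 1)) * (w j * (S - (t : ℂ) • 1))ᴴ).trace =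
        (w j * S * S * (w j)ᴴ).trace - 2 * t * (w j * S * (w j)ᴴ).trace + t * t := fun j => by
      have h3 : ((w j * (S - (t : ℂ) • 1)) * (w j * (S - (t : ℂ) • 1))ᴴ) =
          w j * S * S * (w j)ᴴ - (2 * t : ℂ) • (w j * S * (w j)ᴴ) +
            (t * t : ℂ) • (w j * (w j)ᴴ) := by
        simp only [conjTranspose_mul, conjTranspose_sub, conjTranspose_smul, hSh,
          Complex.star_def, Complex.conj_ofReal, mul_sub, sub_mul, mul_smul_comm, smul_mul_assoc,
          mul_one, mul_assoc]
        module
      rw [h3]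
      simp [hwo]
    have h4 := Finset.sum_nonneg fun j (_ : j ∈ Finset.univ) => h j
    simp only [h2] at h4
    rw [← Complex.re_sum, Finset.sum_add_distrib, Finset.sum_sub_distrib, ← Finset.mul_sum,
      htr1, htr2] at h4
    simp [-Subalgebra.finrank_toSubmodule] at h4
    linarith
  have := discrim_le_zero key
  rw [discrim] at this
  rw [← Nat.cast_le (α := ℝ)]
  push_cast
  linarith

/-- Trace-independent `⋆`-subalgebras satisfy `dim A * dim B ≤ n²`. -/
theorem finrank_mul_finrank_le_sq (A B : StarSubalgebra ℂ (Matrix (Fin n) (Fin n) ℂ))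
    (h : ∀ X ∈ A, ∀ Y ∈ B, n * (X * Y).trace = X.trace * Y.trace) :
    finrank ℂ A * finrank ℂ B ≤ n ^ 2 := by
  obtain ⟨a, ha, hao, -⟩ := exists_trace_orthonormal_basis A.toSubalgebra.toSubmodule
  obtain ⟨b, hb, hbo, -⟩ := exists_trace_orthonormal_basis B.toSubalgebra.toSubmodule
  change finrank ℂ A.toSubalgebra.toSubmodule * finrank ℂ B.toSubalgebra.toSubmodule ≤ n ^ 2
  -- Trace independence is applied to `(a k)ᴴ * a i ∈ A` and `b j * (b l)ᴴ ∈ B`.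
  have hort : ∀ i j k l, n * (a i * b j * (a k * b l)ᴴ).trace =
      if j = l ∧ i = k then 1 else 0 := fun i j k l => by
    have h1 := h _ (mul_mem (star_mem (s := A) (ha k)) (ha i)) _ (mul_mem (hb j) (star_mem (s := B) (hb l)))
    have h2 : (a i * b j * (a k * b l)ᴴ).trace = ((a k)ᴴ * a i * (b j * (b l)ᴴ)).trace := by
      rw [conjTranspose_mul, ← mul_assoc, trace_mul_comm]
      simp only [mul_assoc]
    simp only [star_eq_conjTranspose] at h1
    rw [h2, h1, trace_mul_comm (a k)ᴴ, hao, hbo, ite_and]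
    simp
  have hli : LinearIndependent ℂ
      fun x : Fin (finrank ℂ A.toSubalgebra.toSubmodule) ×
        Fin (finrank ℂ B.toSubalgebra.toSubmodule) => a x.1 * b x.2 := by
    rw [Fintype.linearIndependent_iff]
    intro g hg x
    have h1 := congrArg (fun X => (n : ℂ) * (X * (a x.1 * b x.2)ᴴ).trace) hg
    simp only [Finset.sum_mul, smul_mul_assoc, trace_sum, trace_smul, smul_eq_mul,
      Finset.mul_sum, mul_left_comm (n : ℂ), hort, and_comm, ← Prod.ext_iff] at h1
    simpa using h1
  have := hli.fintype_card_le_finrank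
  simpa [_root_.Module.finrank_matrix, sq] using this

end Matrix

/-- A correctable algebra and a privatized algebra are trace-independent. -/
theorem trace_mul_of_isCorrectable_of_isPrivatizedToState {n m : ℕ}
    {Φ : Matrix (Fin n) (Fin n) ℂ →ₗ[ℂ] Matrix (Fin m) (Fin m) ℂ}
    {A B : StarSubalgebra ℂ (Matrix (Fin n) (Fin n) ℂ)}
    (hA : IsCorrectable A Φ) (hB : IsPrivatizedToState B Φ)
    {X Y : Matrix (Fin n) (Fin n) ℂ} (hX : X ∈ A) (hY : Y ∈ B) :
    n * (X * Y).trace = X.trace * Y.trace := by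
  obtain ⟨R, -, -, hR⟩ := hA
  obtain ⟨ρ, -, -, hρ⟩ := hB
  have h : ∀ Z ∈ B, (Z * X).trace = Z.trace * (ρ * dualMap R X).trace := fun Z hZ => by
    conv_lhs => rw [← hR X hX]
    rw [trace_mul_dualMap, hρ Z hZ, Matrix.smul_mul, Matrix.trace_smul, smul_eq_mul]
  -- `Z = 1` identifies the unknown factor: `n * tr (ρ R†(X)) = tr X`.
  have h1 := h 1 (one_mem B)
  rw [one_mul, Matrix.trace_one, Fintype.card_fin] at h1
  rw [Matrix.trace_mul_comm, h Y hY, h1]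
  ring

theorem mainTheorem9 (n m : ℕ)
    (Φ : Matrix (Fin n) (Fin n) ℂ →ₗ[ℂ] Matrix (Fin m) (Fin m) ℂ) (hΦ : IsChannel Φ)
    (A B : StarSubalgebra ℂ (Matrix (Fin n) (Fin n) ℂ))
    (hA : IsCorrectable A Φ) (hB : IsPrivatizedToState B Φ) :
    Module.finrank ℂ B ≤
        Module.finrank ℂ (Subalgebra.centralizer ℂ (A : Set (Matrix (Fin n) (Fin n) ℂ))) ∧
      Module.finrank ℂ A ≤
        Module.finrank ℂ (Subalgebra.centralizer ℂ (B : Set (Matrix (Fin n) (Fin n) ℂ))) := by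
  -- For `n = 0` both algebras have dimension zero and nothing can be cancelled.
  rcases eq_or_ne n 0 with rfl | hn
  · have hz : ∀ C : StarSubalgebra ℂ (Matrix (Fin 0) (Fin 0) ℂ), Module.finrank ℂ C = 0 :=
      fun C => Module.finrank_zero_of_subsingleton
    simp [hz]
  have : NeZero n := ⟨hn⟩
  have hpos : ∀ C : StarSubalgebra ℂ (Matrix (Fin n) (Fin n) ℂ), 0 < Module.finrank ℂ C :=
    fun C => Module.finrank_pos_iff_exists_ne_zero (M := C.toSubalgebra.toSubmodule) |>.mpr
      ⟨⟨1, one_mem C⟩, fun h => one_ne_zero (congrArg Subtype.val h)⟩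
  have hAB := Matrix.finrank_mul_finrank_le_sq A B fun X hX Y hY =>
    trace_mul_of_isCorrectable_of_isPrivatizedToState hA hB hX hY
  constructor
  · exact Nat.le_of_mul_le_mul_left
      (hAB.trans (Matrix.sq_le_finrank_mul_finrank_centralizer A)) (hpos A)
  · rw [mul_comm] at hAB
    exact Nat.le_of_mul_le_mul_left
      (hAB.trans (Matrix.sq_le_finrank_mul_finrank_centralizer B)) (hpos B)
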